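/- Let $(\Omega,\mathcal F,\mathbb P)$ be a probability space and $(E,d)$ a metric space with its Borel $\sigma$-algebra such that $d(x,y)\le D<\infty$ for all $x,y\in E$. Let $P_X,Q_X$ be Borel probability measures on $E$, let $n,m\ge 1$, let $X_1,\dots,X_n$ be i.i.d. with law $P_X$ and $Z_1,\dots,Z_m$ i.i.d. with law $Q_X$ (no joint independence is required). Let $\Phi:E\to\mathbb R^k$ satisfy $\|\Phi(x)\|_2\le R$ for all $x$, where $R>0$, and be $L_\Phi$-Lipschitz. Put $$\hat P_n=\frac1n\sum_{i=1}^n\delta_{X_i},\qquad \mu_Q=\mathbb E_{Q_X}[\Phi],\qquad \hat\mu_{Q,m}=\frac1m\sum_{j=1}^m\Phi(Z_j).$$ For a probability measure $\rho$ on $E$ let $H_\rho(\xi)=\log\int e^{\langle\xi,\Phi\rangle}\,d\rho$, and write $H=H_{P_X}$. For $t\in\mathbb R^k$, a *dual solution* for $(\rho,t)$ is a minimizer over $\mathbb R^k$ of $\xi\mapsto H_\rho(\xi)-\langle\xi,t\rangle$, and an *I-projection* for $(\rho,t)$ is a minimizer of $\mathrm{KL}(P\,\|\,\rho)$ over the probability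 measures $P\ll\rho$ with $\mathbb E_P[\Phi]=t$. For $\xi\in\mathbb R^k$ let $P_\xi$ be the measure with $\frac{dP_\xi}{dP_X}(x)=\exp(\langle\xi,\Phi(x)\rangle-H(\xi))$. Let $\Xi\subset\mathbb R^k$ be nonempty, compact and convex, and let $L\ge\sigma>0$ be such that $H$ is $\sigma$-strongly convex on $\Xi$ and $\nabla H$ is $L$-Lipschitz on $\Xi$. Let $P^*$ be an I-projection for $(P_X,\mu_Q)$ and let $\xi^*\in\Xi$ be a dual solution for $(P_X,\mu_Q)$. Let $\alpha_n:(0,1)\to(0,\infty)$ be a deterministic function such that, for every $\delta\in(0,1)$, $$\mathbb P\Bigl(\sup_{\xi\in\Xi}\|\nabla H(\xi)-\nabla H_{\hat P_n}(\xi)\|_2\le\alpha_n(\delta)\Bigr)\ge 1-\delta,$$ and put $\beta_m(\delta)=R\sqrt{2k\log(2k/\delta)/m}$. Fix $\delta\in(0,1)$. Let $\mathcal E_\delta\subset\Omega$ be the set of outcomes at which every dual solution $\hat\xi^*\in\Xi$ for $(\hat P_n,\hat\mu_{Q,m})$ satisfies $$\|\hat\xi^*-\xi^*\|_2\le\frac1\sigma\bigl(\alpha_n(\delta)+\beta_m(\delta)\bigr),\qquad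 \mathrm{KL}(P^*\|P_{\hat\xi^*})\le\frac L2\|\hat\xi^*-\xi^*\|_2^2,\qquad d_{\mathrm{TV}}(P^*,P_{\hat\xi^*})\le\sqrt{\tfrac L4\|\hat\xi^*-\xi^*\|_2^2},$$ where $d_{\mathrm{TV}}(P,Q)=\sup_A|P(A)-Q(A)|$. Then $\mathcal E_\delta$ contains a measurable event of probability at least $1-2\delta$. Moreover, at every outcome in $\mathcal E_\delta$ at which a dual solution for $(\hat P_n,\hat\mu_{Q,m})$ exists in $\Xi$, every I-projection $\hat P^*_{n,w}$ for $(\hat P_n,\hat\mu_{Q,m})$ satisfies $$W_1(P^*,\hat P^*_{n,w})\le\frac{D\sqrt L}{2\sigma}\bigl(\alpha_n(\delta)+\beta_m(\delta)\bigr)+C_{\Xi,\Phi,D}\,W_1(P_X,\hat P_n),$$ where $W_1(\mu,\nu)=\inf_\pi\int d(x,y)\,d\pi(x,y)$ over couplings $\pi$ of $\mu,\nu$, and $$C_{\Xi,\Phi,D}=\frac{M_\Xi+DL_w}{m_\Xi}+\frac{DM_\Xi L_w}{m_\Xi^2},\quad B_\Xi=\sup_{\xi\in\Xi}\|\xi\|_2,\quad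 m_\Xi=e^{-B_\Xi R},\quad M_\Xi=e^{B_\Xi R},\quad L_w=B_\Xi L_\Phi e^{B_\Xi R}.$$ -/

import Mathlib

open MeasureTheory ProbabilityTheory
open scoped ENNReal NNReal RealInnerProductSpace

namespace EPA

noncomputable section

/-- The feature space `ℝᵏ` with its Euclidean norm. -/
abbrev Feat (k : ℕ) : Type := EuclideanSpace ℝ (Fin k)

/-- The 1-Wasserstein distance: the infimum of the transport cost `∫ d(x, y) dπ(x, y)` over all
couplings `π` of `μ` and `ν`. -/
def W1 {E : Type*} [MetricSpace E] [MeasurableSpace E] (μ ν : Measure E) : ℝ≥0∞ :=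
  ⨅ (π : Measure (E × E)) (_ : π.map Prod.fst = μ) (_ : π.map Prod.snd = ν),
    ∫⁻ p, edist p.1 p.2 ∂π

/-- The total variation distance `sup_A |μ(A) - ν(A)|`, over measurable sets `A`. -/
def tvDist {E : Type*} [MeasurableSpace E] (μ ν : Measure E) : ℝ :=
  ⨆ A : {s : Set E // MeasurableSet s}, |μ.real A.1 - ν.real A.1|

/-- The empirical measure `(1/n) ∑ᵢ δ_{xᵢ}`. -/
def empMeasure {E : Type*} [MeasurableSpace E] {n : ℕ} (x : Fin n → E) : Measure E :=
  (n : ℝ≥0∞)⁻¹ • ∑ i, Measure.dirac (x i)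

/-- The empirical moment `(1/m) ∑ⱼ Φ(zⱼ)`. -/
def empMoment {E : Type*} {k m : ℕ} (Φ : E → Feat k) (z : Fin m → E) : Feat k :=
  (m : ℝ)⁻¹ • ∑ j, Φ (z j)

/-- The log-partition function `H_ρ(ξ) = log ∫ exp⟨ξ, Φ⟩ dρ`. -/
def logPartition {E : Type*} [MeasurableSpace E] {k : ℕ} (ρ : Measure E) (Φ : E → Feat k)
    (ξ : Feat k) : ℝ :=
  Real.log (∫ x, Real.exp ⟪ξ, Φ x⟫ ∂ρ)

/-- `ξ` is a dual solution for the reference measure `ρ` and the moment `t`: it minimizes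
`η ↦ H_ρ(η) - ⟨η, t⟩` over the whole of `ℝᵏ`. -/
def IsDualSolution {E : Type*} [MeasurableSpace E] {k : ℕ} (ρ : Measure E) (Φ : E → Feat k)
    (t : Feat k) (ξ : Feat k) : Prop :=
  ∀ η : Feat k, logPartition ρ Φ ξ - ⟪ξ, t⟫ ≤ logPartition ρ Φ η - ⟪η, t⟫

/-- `P` is feasible for the moment problem: a probability measure, absolutely continuous with
respect to `ρ`, with `E_P[Φ] = t`. -/
def IsFeasible {E : Type*} [MeasurableSpace E] {k : ℕ} (ρ : Measure E) (Φ : E → Feat k)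
    (t : Feat k) (P : Measure E) : Prop :=
  IsProbabilityMeasure P ∧ P ≪ ρ ∧ Integrable Φ P ∧ ∫ x, Φ x ∂P = t

/-- `P` minimizes `KL(· ‖ ρ)` among all feasible measures. -/
def IsIProjection {E : Type*} [MeasurableSpace E] {k : ℕ} (ρ : Measure E) (Φ : E → Feat k)
    (t : Feat k) (P : Measure E) : Prop :=
  IsFeasible ρ Φ t P ∧
    ∀ P' : Measure E, IsFeasible ρ Φ t P' →
      InformationTheory.klDiv P ρ ≤ InformationTheory.klDiv P' ρ

/-- The member `P_ξ` of the exponential family generated by `ρ` and `Φ`: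
`dP_ξ/dρ = exp⟨ξ, Φ⟩ / ∫ exp⟨ξ, Φ⟩ dρ = exp(⟨ξ, Φ⟩ - H_ρ(ξ))`. -/
def expFamily {E : Type*} [MeasurableSpace E] {k : ℕ} (ρ : Measure E) (Φ : E → Feat k)
    (ξ : Feat k) : Measure E :=
  ρ.tilted (fun x => ⟪ξ, Φ x⟫)

/-- `β_m(δ) = R √(2 k log(2k/δ) / m)`. -/
def betaRate (R : ℝ) (k m : ℕ) (δ : ℝ) : ℝ :=
  R * Real.sqrt (2 * k * Real.log (2 * k / δ) / m)

/-- `B_Ξ = sup_{ξ ∈ Ξ} ‖ξ‖`. -/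
def normBound {k : ℕ} (Ξ : Set (Feat k)) : ℝ :=
  sSup ((fun ξ => ‖ξ‖) '' Ξ)

/-- `L_w = B_Ξ L_Φ exp(B_Ξ R)`. -/
def weightLip {k : ℕ} (Ξ : Set (Feat k)) (R LΦ : ℝ) : ℝ :=
  normBound Ξ * LΦ * Real.exp (normBound Ξ * R)

/-- `C = (M + D L_w) / m + D M L_w / m²`, with `m = exp(-B_Ξ R)` and `M = exp(B_Ξ R)`. -/
def stabConst {k : ℕ} (Ξ : Set (Feat k)) (R LΦ D : ℝ) : ℝ :=
  (Real.exp (normBound Ξ * R) + D * weightLip Ξ R LΦ) / Real.exp (-(normBound Ξ * R))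
    + D * Real.exp (normBound Ξ * R) * weightLip Ξ R LΦ / Real.exp (-(normBound Ξ * R)) ^ 2

/-- The outcomes at which the three finite-sample bounds (dual parameter, Kullback-Leibler and
total variation errors) hold for the empirical dual solution, whenever there is one in `Ξ`.
Here `a` and `b` are the two error levels, `x ω` is the source sample and `z ω` the target
sample. -/
def boundsEvent {Ω E : Type*} [MeasurableSpace E] {k n m : ℕ} (PX : Measure E)
    (Φ : E → Feat k) (Ξ : Set (Feat k)) (σ L a b : ℝ) (ξstar : Feat k) (Pstar : Measure E)
    (x : Ω → Fin n → E) (z : Ω → Fin m → E) : Set Ω :=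
  {ω | ∀ ξhat ∈ Ξ, IsDualSolution (empMeasure (x ω)) Φ (empMoment Φ (z ω)) ξhat →
    ‖ξhat - ξstar‖ ≤ 1 / σ * (a + b) ∧
    InformationTheory.klDiv Pstar (expFamily PX Φ ξhat)
      ≤ ENNReal.ofReal (L / 2 * ‖ξhat - ξstar‖ ^ 2) ∧
    tvDist Pstar (expFamily PX Φ ξhat) ≤ Real.sqrt (L / 4 * ‖ξhat - ξstar‖ ^ 2)}

end

end EPA

namespace EPA

/-! ### Exponential families: gradient of the log-partition function, divergences, I-projections. -/

section ExponentialFamily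

/-! Since `∇H_ρ(ξ)` is the mean of `Φ` under the tilt `P_ξ` of `ρ`, stationarity of a dual solution
says that `P_ξ` is feasible. For feasible `P`, `KL(P‖P_ξ) = KL(P‖ρ) - ⟨ξ, t⟩ + H_ρ(ξ)`, so an
I-projection must be `P_ξ` (`IsIProjection.eq_expFamily`). Thus `P*` is the tilt of `P_X` by `ξ*`,
and the empirical projection is the tilt of `P̂_n` by `ξ̂`.

Parameter, KL and TV bounds: `∇H(ξ*) = μ_Q` and `∇H_{P̂_n}(ξ̂) = μ̂`, so `∇H(ξ̂)` and `∇H(ξ*)`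
differ by at most `α + β`, where `β` comes from coordinatewise Hoeffding and a union bound; strong
convexity turns this into a bound on `ξ̂ - ξ*`. The divergence `KL(P_ξ*‖P_ξ̂)` is a Bregman
divergence of `H`, controlled by the descent lemma, and Pinsker gives total variation.

Wasserstein bound (`W1_expFamily_le`): let `p₁, p₂` be the densities of `P_ξ*, P_ξ̂` with respect to
`P_X`, and `q` that of the empirical tilt with respect to `P̂_n`. Given a coupling of `P_X` and
`P̂_n`, the mass `min(p₁(x), p₂(x), q(y))`, at most `M/m`, moves along it; the rest is coupled
independently at cost at most `D` per unit. The rest has mass at most `TV(P_ξ*, P_ξ̂)` plus `2 L_w /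
m` times the original transport cost. -/

lemma abs_inner_le_of_norm_le {E : Type*} {k : ℕ} {Φ : E → Feat k} {R : ℝ}
    (hR : ∀ x, ‖Φ x‖ ≤ R) (ξ : Feat k) (x : E) : |⟪ξ, Φ x⟫| ≤ ‖ξ‖ * R :=
  (abs_real_inner_le_norm _ _).trans (mul_le_mul_of_nonneg_left (hR x) (norm_nonneg _))

lemma exp_inner_le {E : Type*} {k : ℕ} {Φ : E → Feat k} {R : ℝ}
    (hR : ∀ x, ‖Φ x‖ ≤ R) (ξ : Feat k) (x : E) :
    Real.exp ⟪ξ, Φ x⟫ ≤ Real.exp (‖ξ‖ * R) :=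
  Real.exp_le_exp.2 (abs_le.1 (abs_inner_le_of_norm_le hR ξ x)).2

lemma le_exp_inner {E : Type*} {k : ℕ} {Φ : E → Feat k} {R : ℝ}
    (hR : ∀ x, ‖Φ x‖ ≤ R) (ξ : Feat k) (x : E) :
    Real.exp (-(‖ξ‖ * R)) ≤ Real.exp ⟪ξ, Φ x⟫ :=
  Real.exp_le_exp.2 (abs_le.1 (abs_inner_le_of_norm_le hR ξ x)).1

variable {E : Type*} [MeasurableSpace E] {k : ℕ}

lemma integrable_of_norm_le {F : Type*} [NormedAddCommGroup F] {f : E → F}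
    {ρ : Measure E} [IsFiniteMeasure ρ] (hf : AEStronglyMeasurable f ρ) {C : ℝ}
    (hC : ∀ x, ‖f x‖ ≤ C) : Integrable f ρ :=
  Integrable.of_bound hf C (ae_of_all _ hC)

variable {Φ : E → Feat k} {R : ℝ}

lemma integrable_features (ρ : Measure E) [IsFiniteMeasure ρ] (hΦ : Measurable Φ)
    (hR : ∀ x, ‖Φ x‖ ≤ R) : Integrable Φ ρ :=
  integrable_of_norm_le hΦ.aestronglyMeasurable hR

lemma integrable_inner_features (ρ : Measure E) [IsFiniteMeasure ρ] (hΦ : Measurable Φ)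
    (hR : ∀ x, ‖Φ x‖ ≤ R) (ξ : Feat k) : Integrable (fun x => ⟪ξ, Φ x⟫) ρ :=
  (integrable_features ρ hΦ hR).const_inner ξ

lemma integrable_exp_inner (ρ : Measure E) [IsFiniteMeasure ρ] (hΦ : Measurable Φ)
    (hR : ∀ x, ‖Φ x‖ ≤ R) (ξ : Feat k) : Integrable (fun x => Real.exp ⟪ξ, Φ x⟫) ρ := by
  refine integrable_of_norm_le (C := Real.exp (‖ξ‖ * R)) ?_ fun x => ?_
  · exact (hΦ.const_inner (c := ξ)).exp.aestronglyMeasurable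
  · rw [Real.norm_eq_abs, Real.abs_exp]
    exact exp_inner_le hR ξ x

lemma isProbabilityMeasure_expFamily (ρ : Measure E) [IsProbabilityMeasure ρ] (hΦ : Measurable Φ)
    (hR : ∀ x, ‖Φ x‖ ≤ R) (ξ : Feat k) : IsProbabilityMeasure (expFamily ρ Φ ξ) :=
  isProbabilityMeasure_tilted (integrable_exp_inner ρ hΦ hR ξ)

lemma integral_exp_inner_pos (ρ : Measure E) [IsProbabilityMeasure ρ] (hΦ : Measurable Φ)
    (hR : ∀ x, ‖Φ x‖ ≤ R) (ξ : Feat k) : 0 < ∫ x, Real.exp ⟪ξ, Φ x⟫ ∂ρ :=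
  integral_exp_pos (integrable_exp_inner ρ hΦ hR ξ)

/-- The gradient of the log-partition function is the mean of the features under the
corresponding member of the exponential family. -/
lemma hasGradientAt_logPartition (ρ : Measure E) [IsProbabilityMeasure ρ] (hΦ : Measurable Φ)
    (hR : ∀ x, ‖Φ x‖ ≤ R) (ξ : Feat k) :
    HasGradientAt (logPartition ρ Φ) (∫ x, Φ x ∂(expFamily ρ Φ ξ)) ξ := by
  have hderiv : HasFDerivAt (fun η : Feat k => ∫ x, Real.exp ⟪η, Φ x⟫ ∂ρ)
      (∫ x, Real.exp ⟪ξ, Φ x⟫ • innerSL ℝ (Φ x) ∂ρ) ξ := by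
    -- Differentiation under the integral: on the unit ball around `ξ`, `‖η‖ ≤ ‖ξ‖ + 1`, which
    -- yields a constant dominating function.
    refine hasFDerivAt_integral_of_dominated_of_fderiv_le
      (F' := fun η x => Real.exp ⟪η, Φ x⟫ • innerSL ℝ (Φ x))
      (bound := fun _ => Real.exp ((‖ξ‖ + 1) * R) * R)
      (Metric.ball_mem_nhds ξ one_pos) ?_ (integrable_exp_inner ρ hΦ hR ξ) ?_ ?_
      (integrable_const _) ?_
    · exact Filter.Eventually.of_forall fun η =>
        (integrable_exp_inner ρ hΦ hR η).aestronglyMeasurable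
    · refine AEStronglyMeasurable.smul (integrable_exp_inner ρ hΦ hR ξ).aestronglyMeasurable ?_
      exact (innerSL ℝ).continuous.comp_aestronglyMeasurable hΦ.aestronglyMeasurable
    · refine ae_of_all _ fun x η hη => ?_
      have hR0 : 0 ≤ R := (norm_nonneg _).trans (hR x)
      have hη' : ‖η‖ ≤ ‖ξ‖ + 1 := by
        have h1 : ‖η - ξ‖ < 1 := by simpa [dist_eq_norm] using hη
        have h2 := norm_add_le (η - ξ) ξ
        rw [sub_add_cancel] at h2
        linarith
      rw [norm_smul, Real.norm_eq_abs, Real.abs_exp, innerSL_apply_norm]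
      refine mul_le_mul ((exp_inner_le hR η x).trans ?_) (hR x) (norm_nonneg _)
        (Real.exp_pos _).le
      exact Real.exp_le_exp.2 (mul_le_mul_of_nonneg_right hη' hR0)
    · refine ae_of_all _ fun x η _ => ?_
      have h : HasFDerivAt (fun η : Feat k => ⟪η, Φ x⟫) (innerSL ℝ (Φ x)) η := by
        refine (innerSL ℝ (Φ x)).hasFDerivAt.congr_of_eventuallyEq ?_
        exact Filter.Eventually.of_forall fun η => (real_inner_comm _ _)
      exact h.exp
  have hlog := hderiv.log (integral_exp_inner_pos ρ hΦ hR ξ).ne'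
  rw [hasGradientAt_iff_hasFDerivAt]
  refine HasFDerivAt.congr_fderiv (f := logPartition ρ Φ) hlog ?_
  ext1 v
  symm
  have hint : Integrable (fun x => Real.exp ⟪ξ, Φ x⟫ • innerSL ℝ (Φ x)) ρ := by
    refine integrable_of_norm_le (C := Real.exp (‖ξ‖ * R) * R) ?_ fun x => ?_
    · refine AEStronglyMeasurable.smul (integrable_exp_inner ρ hΦ hR ξ).aestronglyMeasurable ?_
      exact (innerSL ℝ).continuous.comp_aestronglyMeasurable hΦ.aestronglyMeasurable
    · rw [norm_smul, Real.norm_eq_abs, Real.abs_exp, innerSL_apply_norm]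
      exact mul_le_mul (exp_inner_le hR ξ x) (hR x) (norm_nonneg _) (Real.exp_pos _).le
  have := isProbabilityMeasure_expFamily ρ hΦ hR ξ
  rw [InnerProductSpace.toDual_apply_apply, smul_apply,
    ContinuousLinearMap.integral_apply hint, real_inner_comm,
    ← integral_inner (integrable_features _ hΦ hR), expFamily, integral_tilted, smul_eq_mul,
    ← integral_const_mul]
  refine integral_congr_ae (ae_of_all _ fun x => ?_)
  simp only [smul_apply, innerSL_apply_apply, smul_eq_mul,
    real_inner_comm v (Φ x)]
  ring

lemma gradient_logPartition (ρ : Measure E) [IsProbabilityMeasure ρ] (hΦ : Measurable Φ)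
    (hR : ∀ x, ‖Φ x‖ ≤ R) (ξ : Feat k) :
    gradient (logPartition ρ Φ) ξ = ∫ x, Φ x ∂(expFamily ρ Φ ξ) :=
  (hasGradientAt_logPartition ρ hΦ hR ξ).gradient

/-- First-order optimality of dual solutions. -/
lemma IsDualSolution.gradient_eq {ρ : Measure E} [IsProbabilityMeasure ρ] (hΦ : Measurable Φ)
    (hR : ∀ x, ‖Φ x‖ ≤ R) {t ξ : Feat k} (h : IsDualSolution ρ Φ t ξ) :
    gradient (logPartition ρ Φ) ξ = t := by
  have hg := hasGradientAt_logPartition ρ hΦ hR ξ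
  have hmin : IsLocalMin (fun η => logPartition ρ Φ η - ⟪η, t⟫) ξ :=
    Filter.Eventually.of_forall h
  have hl : HasFDerivAt (fun η : Feat k => ⟪η, t⟫) (innerSL ℝ t) ξ := by
    refine (innerSL ℝ t).hasFDerivAt.congr_of_eventuallyEq ?_
    exact Filter.Eventually.of_forall fun η => (real_inner_comm _ _)
  have h0 := hmin.hasFDerivAt_eq_zero (hg.hasFDerivAt.sub hl)
  rw [hg.gradient, ← sub_eq_zero]
  set w := ∫ x, Φ x ∂(expFamily ρ Φ ξ)
  -- Testing the vanishing derivative on `w - t` itself gives `‖w - t‖² = 0`.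
  have h1 := congrArg (fun l => l (w - t)) h0
  simp only [sub_apply, InnerProductSpace.toDual_apply_apply,
    innerSL_apply_apply, zero_apply, ← inner_sub_left] at h1
  exact inner_self_eq_zero.1 h1

lemma isFeasible_expFamily {ρ : Measure E} [IsProbabilityMeasure ρ] (hΦ : Measurable Φ)
    (hR : ∀ x, ‖Φ x‖ ≤ R) (ξ : Feat k) :
    IsFeasible ρ Φ (gradient (logPartition ρ Φ) ξ) (expFamily ρ Φ ξ) := by
  have := isProbabilityMeasure_expFamily ρ hΦ hR ξ
  exact ⟨this, tilted_absolutelyContinuous _ _, integrable_features _ hΦ hR,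
    (gradient_logPartition ρ hΦ hR ξ).symm⟩

open InformationTheory

/-- Integrate `log dP/dP_ξ = log dP/dρ - ⟨ξ, Φ⟩ + H_ρ(ξ)` against `P`. The correction depends on `P`
only through its moment, so it is constant on the feasible set. -/
lemma toReal_klDiv_expFamily_right {ρ P : Measure E} [IsProbabilityMeasure ρ]
    [IsProbabilityMeasure P] (hΦ : Measurable Φ) (hR : ∀ x, ‖Φ x‖ ≤ R) (ξ : Feat k)
    (hP : P ≪ ρ) (hfin : klDiv P ρ ≠ ∞) :
    klDiv P (expFamily ρ Φ ξ) ≠ ∞ ∧ (klDiv P (expFamily ρ Φ ξ)).toReal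
      = (klDiv P ρ).toReal - ⟪ξ, ∫ x, Φ x ∂P⟫ + logPartition ρ Φ ξ := by
  have := isProbabilityMeasure_expFamily ρ hΦ hR ξ
  have hint := (klDiv_ne_top_iff.1 hfin).2
  have hac : P ≪ expFamily ρ Φ ξ :=
    hP.trans (absolutelyContinuous_tilted (integrable_exp_inner ρ hΦ hR ξ))
  refine ⟨klDiv_ne_top hac (integrable_llr_tilted_right hP
    (integrable_inner_features P hΦ hR ξ) hint (integrable_exp_inner ρ hΦ hR ξ)), ?_⟩
  rw [toReal_klDiv_of_measure_eq hac (by simp), toReal_klDiv_of_measure_eq hP (by simp),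
    expFamily, integral_llr_tilted_right hP (integrable_inner_features P hΦ hR ξ)
      (integrable_exp_inner ρ hΦ hR ξ) hint, integral_inner (integrable_features P hΦ hR),
    logPartition]

lemma toReal_klDiv_expFamily_self {ρ : Measure E} [IsProbabilityMeasure ρ]
    (hΦ : Measurable Φ) (hR : ∀ x, ‖Φ x‖ ≤ R) (ξ : Feat k) :
    klDiv (expFamily ρ Φ ξ) ρ ≠ ∞ ∧ (klDiv (expFamily ρ Φ ξ) ρ).toReal
      = ⟪ξ, gradient (logPartition ρ Φ) ξ⟫ - logPartition ρ Φ ξ := by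
  have := isProbabilityMeasure_expFamily ρ hΦ hR ξ
  have hac : expFamily ρ Φ ξ ≪ ρ := tilted_absolutelyContinuous _ _
  have hllr : llr (expFamily ρ Φ ξ) ρ =ᵐ[expFamily ρ Φ ξ]
      fun x => ⟪ξ, Φ x⟫ - logPartition ρ Φ ξ :=
    hac.ae_le (log_rnDeriv_tilted_left_self (integrable_exp_inner ρ hΦ hR ξ))
  have hi := integrable_inner_features (expFamily ρ Φ ξ) hΦ hR ξ
  refine ⟨klDiv_ne_top hac ((integrable_congr hllr).2 (hi.sub (integrable_const _))), ?_⟩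
  rw [toReal_klDiv_of_measure_eq hac (by simp), integral_congr_ae hllr,
    integral_sub hi (integrable_const _), integral_inner (integrable_features _ hΦ hR),
    gradient_logPartition ρ hΦ hR]
  simp

/-- Between members of an exponential family, the Kullback-Leibler divergence is the Bregman
divergence of the log-partition function. -/
lemma klDiv_expFamily_expFamily {ρ : Measure E} [IsProbabilityMeasure ρ]
    (hΦ : Measurable Φ) (hR : ∀ x, ‖Φ x‖ ≤ R) (ξ η : Feat k) :
    klDiv (expFamily ρ Φ ξ) (expFamily ρ Φ η) = ENNReal.ofReal (logPartition ρ Φ η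
      - logPartition ρ Φ ξ - ⟪gradient (logPartition ρ Φ) ξ, η - ξ⟫) := by
  have := isProbabilityMeasure_expFamily ρ hΦ hR ξ
  obtain ⟨h1, h2⟩ := toReal_klDiv_expFamily_self (ρ := ρ) hΦ hR ξ
  obtain ⟨h3, h4⟩ := toReal_klDiv_expFamily_right (P := expFamily ρ Φ ξ) hΦ hR η
    (tilted_absolutelyContinuous ρ fun x => ⟪ξ, Φ x⟫) h1
  rw [← ENNReal.ofReal_toReal h3, h4]
  rw [h2, ← gradient_logPartition ρ hΦ hR, inner_sub_right,
    real_inner_comm ξ, real_inner_comm η]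
  congr 1
  ring

/-- When a dual solution exists, the I-projection is the corresponding member of the exponential
family. -/
lemma IsIProjection.eq_expFamily {ρ P : Measure E} [IsProbabilityMeasure ρ]
    (hΦ : Measurable Φ) (hR : ∀ x, ‖Φ x‖ ≤ R) {t ξ : Feat k} (hP : IsIProjection ρ Φ t P)
    (hξ : IsDualSolution ρ Φ t ξ) : P = expFamily ρ Φ ξ := by
  have hg := hξ.gradient_eq hΦ hR
  have hle := hP.2 _ (hg ▸ isFeasible_expFamily hΦ hR ξ)
  obtain ⟨⟨hprob, hac, -, hmean⟩, -⟩ := hP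
  have := isProbabilityMeasure_expFamily ρ hΦ hR ξ
  obtain ⟨h1, h2⟩ := toReal_klDiv_expFamily_self (ρ := ρ) hΦ hR ξ
  obtain ⟨h3, h4⟩ := toReal_klDiv_expFamily_right hΦ hR ξ hac (ne_top_of_le_ne_top h1 hle)
  have h5 := ENNReal.toReal_mono h1 hle
  rw [hmean] at h4
  rw [h2, hg] at h5
  -- The divergence equals `KL(P‖ρ) - KL(P_ξ‖ρ)`, which is nonpositive by optimality of `P`.
  have h6 : (klDiv P (expFamily ρ Φ ξ)).toReal = 0 :=
    le_antisymm (by linarith) ENNReal.toReal_nonneg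
  exact klDiv_eq_zero_iff.1 (((ENNReal.toReal_eq_zero_iff _).1 h6).resolve_right h3)

end ExponentialFamily

/-! ### Strong convexity and smoothness on a convex set. -/

section ConvexAnalysis

variable {F : Type*} [NormedAddCommGroup F] [InnerProductSpace ℝ F] [CompleteSpace F]

lemma hasDerivAt_comp_segment {f : F → ℝ} {g : F → F} (hg : ∀ x, HasGradientAt f (g x) x)
    (x v : F) (t : ℝ) : HasDerivAt (fun s : ℝ => f (x + s • v)) ⟪g (x + t • v), v⟫ t := by
  have h : HasDerivAt (fun s : ℝ => x + s • v) v t := by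
    simpa using ((hasDerivAt_id t).smul_const v).const_add x
  exact (hg (x + t • v)).hasFDerivAt.comp_hasDerivAt t h

/-- Divide the strong convexity inequality at `x + t(y - x)` by `t` and let `t ↓ 0`; the factor `1 -
t` of the quadratic term tends to one. -/
lemma _root_.StrongConvexOn.add_inner_add_le {f : F → ℝ} {g : F → F}
    (hg : ∀ x, HasGradientAt f (g x) x) {s : Set F} {σ : ℝ} (hf : StrongConvexOn s σ f)
    {x y : F} (hx : x ∈ s) (hy : y ∈ s) :
    f x + ⟪g x, y - x⟫ + σ / 2 * ‖y - x‖ ^ 2 ≤ f y := by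
  have hd := hasDerivAt_comp_segment hg x (y - x) 0
  have hlim := hd.tendsto_slope_zero_right
  simp only [zero_add, zero_smul, add_zero, smul_eq_mul] at hlim
  have hlim2 : Filter.Tendsto (fun t : ℝ => f y - f x - (1 - t) * (σ / 2 * ‖y - x‖ ^ 2))
      (nhdsWithin 0 (Set.Ioi 0)) (nhds (f y - f x - (1 - 0) * (σ / 2 * ‖y - x‖ ^ 2))) := by
    refine Filter.Tendsto.mono_left (Continuous.tendsto (by fun_prop) 0) nhdsWithin_le_nhds
  have hle := le_of_tendsto_of_tendsto hlim hlim2 (by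
    filter_upwards [Ioo_mem_nhdsGT (zero_lt_one' ℝ)] with t ht
    have h := hf.2 hx hy (sub_nonneg.2 ht.2.le) ht.1.le (by ring)
    have hpt : (1 - t) • x + t • y = x + t • (y - x) := by module
    rw [hpt] at h
    simp only [smul_eq_mul] at h
    rw [norm_sub_rev x y] at h
    rw [inv_mul_le_iff₀ ht.1]
    linarith)
  linarith

/-- The gradient of a strongly convex function is strongly monotone, hence expanding. -/
lemma _root_.StrongConvexOn.mul_norm_sub_le {f : F → ℝ} {g : F → F}
    (hg : ∀ x, HasGradientAt f (g x) x) {s : Set F} {σ : ℝ} (hf : StrongConvexOn s σ f)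
    {x y : F} (hx : x ∈ s) (hy : y ∈ s) : σ * ‖y - x‖ ≤ ‖g y - g x‖ := by
  -- Adding the inequality to its mirror image cancels the values of `f` and leaves `σ‖y - x‖² ≤ ⟨g
  -- y - g x, y - x⟩`.
  have h1 := hf.add_inner_add_le hg hx hy
  have h2 := hf.add_inner_add_le hg hy hx
  rw [norm_sub_rev x y, ← neg_sub y x, inner_neg_right] at h2
  have h3 := real_inner_le_norm (g y - g x) (y - x)
  rw [inner_sub_left] at h3
  rcases (norm_nonneg (y - x)).eq_or_lt with h0 | h0
  · rw [← h0, mul_zero]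
    exact norm_nonneg _
  · refine le_of_mul_le_mul_right ?_ h0
    nlinarith

/-- The descent lemma on a convex set. -/
lemma le_add_inner_add_of_lipschitz_gradient {f : F → ℝ} {g : F → F}
    (hg : ∀ x, HasGradientAt f (g x) x) {s : Set F} (hs : Convex ℝ s) {L : ℝ}
    (hL : ∀ x ∈ s, ∀ y ∈ s, ‖g x - g y‖ ≤ L * ‖x - y‖)
    {x y : F} (hx : x ∈ s) (hy : y ∈ s) :
    f y - f x - ⟪g x, y - x⟫ ≤ L / 2 * ‖y - x‖ ^ 2 := by
  set v := y - x with hv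
  -- The claim is `φ 1 ≤ φ 0`; the Lipschitz bound makes `φ' ≤ 0` on the segment, so no integral of
  -- the gradient is needed.
  set φ : ℝ → ℝ := fun t => f (x + t • v) - t * ⟪g x, v⟫ - L / 2 * ‖v‖ ^ 2 * t ^ 2 with hφ
  have hd : ∀ t, HasDerivAt φ (⟪g (x + t • v), v⟫ - ⟪g x, v⟫ - L * ‖v‖ ^ 2 * t) t := by
    intro t
    have h1 := hasDerivAt_comp_segment hg x v t
    have h2 := (hasDerivAt_id t).mul_const ⟪g x, v⟫
    have h3 := (hasDerivAt_pow 2 t).const_mul (L / 2 * ‖v‖ ^ 2)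
    refine ((h1.sub h2).sub h3).congr_deriv ?_
    push_cast
    ring
  have hanti : AntitoneOn φ (Set.Icc 0 1) := by
    refine antitoneOn_of_deriv_nonpos (convex_Icc 0 1)
      (fun t _ => (hd t).continuousAt.continuousWithinAt)
      (fun t _ => (hd t).differentiableAt.differentiableWithinAt) fun t ht => ?_
    rw [interior_Icc] at ht
    rw [(hd t).deriv]
    have hmem : x + t • v ∈ s := hs.add_smul_sub_mem hx hy ⟨ht.1.le, ht.2.le⟩
    have h1 := hL _ hmem _ hx
    rw [add_sub_cancel_left, norm_smul, Real.norm_of_nonneg ht.1.le] at h1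
    have h2 := real_inner_le_norm (g (x + t • v) - g x) v
    rw [inner_sub_left] at h2
    have h3 := mul_le_mul_of_nonneg_right h1 (norm_nonneg v)
    nlinarith
  have h := hanti (Set.left_mem_Icc.2 zero_le_one) (Set.right_mem_Icc.2 zero_le_one) zero_le_one
  simp only [hφ, one_smul, zero_smul, add_zero, hv, add_sub_cancel] at h
  simp only [hv]
  linarith

end ConvexAnalysis

/-! ### Donsker-Varadhan and Pinsker inequalities. -/

section Pinsker

variable {E : Type*} [MeasurableSpace E]

open InformationTheory

lemma abs_measureReal_sub_le_one (P Q : Measure E) [IsProbabilityMeasure P]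
    [IsProbabilityMeasure Q] (A : Set E) : |P.real A - Q.real A| ≤ 1 := by
  have h1 : P.real A ≤ 1 := measureReal_le_one
  have h2 : Q.real A ≤ 1 := measureReal_le_one
  have h3 : 0 ≤ P.real A := measureReal_nonneg
  have h4 : 0 ≤ Q.real A := measureReal_nonneg
  rw [abs_le]
  constructor <;> linarith

lemma measureReal_sub_le_tvDist (P Q : Measure E) [IsProbabilityMeasure P]
    [IsProbabilityMeasure Q] {A : Set E} (hA : MeasurableSet A) :
    P.real A - Q.real A ≤ tvDist P Q := by
  have hb : BddAbove (Set.range fun A : {s : Set E // MeasurableSet s} =>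
      |P.real A.1 - Q.real A.1|) :=
    ⟨1, by rintro _ ⟨A, rfl⟩; exact abs_measureReal_sub_le_one P Q A.1⟩
  exact (le_abs_self _).trans (le_ciSup hb ⟨A, hA⟩)

/-- The Donsker-Varadhan inequality for bounded functions. -/
lemma integral_sub_log_integral_exp_le_klDiv {P Q : Measure E} [IsProbabilityMeasure P]
    [IsProbabilityMeasure Q] (hfin : klDiv P Q ≠ ∞) {f : E → ℝ} (hf : Measurable f) {C : ℝ}
    (hC : ∀ x, |f x| ≤ C) :
    ∫ x, f x ∂P - Real.log (∫ x, Real.exp (f x) ∂Q) ≤ (klDiv P Q).toReal := by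
  obtain ⟨hac, hint⟩ := klDiv_ne_top_iff.1 hfin
  have hfP : Integrable f P := Integrable.of_bound hf.aestronglyMeasurable C (ae_of_all _ hC)
  have heQ : Integrable (fun x => Real.exp (f x)) Q :=
    Integrable.of_bound hf.exp.aestronglyMeasurable (Real.exp C) (ae_of_all _ fun x => by
      rw [Real.norm_eq_abs, Real.abs_exp]
      exact Real.exp_le_exp.2 ((le_abs_self _).trans (hC x)))
  have := isProbabilityMeasure_tilted heQ
  -- The inequality is the nonnegativity of the divergence of `P` from the tilt of `Q` by `f`.
  have h1 := toReal_klDiv_of_measure_eq (hac.trans (absolutelyContinuous_tilted heQ))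
    (by simp : P Set.univ = (Q.tilted f) Set.univ)
  rw [integral_llr_tilted_right hac hfP heQ hint,
    ← toReal_klDiv_of_measure_eq hac (by simp)] at h1
  have h2 : 0 ≤ (klDiv P (Q.tilted f)).toReal := ENNReal.toReal_nonneg
  linarith

/-- Donsker-Varadhan applied to `λ(1_A - Q(A))`, whose log-moment under `Q` is at most `λ²/8` by
Hoeffding's lemma. -/
lemma two_mul_sq_measureReal_sub_le_klDiv {P Q : Measure E} [IsProbabilityMeasure P]
    [IsProbabilityMeasure Q] (hfin : klDiv P Q ≠ ∞) {A : Set E} (hA : MeasurableSet A) :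
    2 * (P.real A - Q.real A) ^ 2 ≤ (klDiv P Q).toReal := by
  set Δ := P.real A - Q.real A with hΔ
  set u : E → ℝ := A.indicator 1 with hu
  have hum : Measurable u := measurable_one.indicator hA
  have hu01 : ∀ x, u x ∈ Set.Icc (0 : ℝ) 1 := fun x => by
    by_cases hx : x ∈ A <;> simp [hu, hx]
  have hQu : ∫ x, u x ∂Q = Q.real A := integral_indicator_one hA
  have hPu : ∫ x, u x ∂P = P.real A := integral_indicator_one hA
  have hsub := hasSubgaussianMGF_of_mem_Icc (μ := Q) hum.aemeasurable (ae_of_all _ hu01)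
  -- `λ = 4Δ` maximizes `λΔ - λ²/8`, with value `2Δ²`; it is signed, so both signs of `Δ` are
  -- covered.
  have hmgf := hsub.mgf_le (4 * Δ)
  have hQ1 : Q.real A ≤ 1 := measureReal_le_one
  have hQ0 : 0 ≤ Q.real A := measureReal_nonneg
  have hdv := integral_sub_log_integral_exp_le_klDiv (f := fun x => 4 * Δ * (u x - Q.real A))
    (C := |4 * Δ|) hfin (by fun_prop) fun x => by
      rw [abs_mul]
      refine mul_le_of_le_one_right (abs_nonneg _) (abs_le.2 ?_)
      constructor <;> linarith [(hu01 x).1, (hu01 x).2]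
  have hPi : ∫ x, 4 * Δ * (u x - Q.real A) ∂P = 4 * Δ * Δ := by
    rw [integral_const_mul, integral_sub _ (integrable_const _), hPu]
    · simp [hΔ]
    · exact Integrable.of_mem_Icc 0 1 hum.aemeasurable (ae_of_all _ hu01)
  have hlog : Real.log (∫ x, Real.exp (4 * Δ * (u x - Q.real A)) ∂Q) ≤ 2 * Δ ^ 2 := by
    rw [mgf, hQu] at hmgf
    have hpos : 0 < ∫ x, Real.exp (4 * Δ * (u x - Q.real A)) ∂Q := by
      have := hsub.integrable_exp_mul (4 * Δ)
      rw [hQu] at this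
      exact integral_exp_pos this
    rw [Real.log_le_iff_le_exp hpos]
    refine hmgf.trans (Real.exp_le_exp.2 (le_of_eq ?_))
    simp
    ring
  rw [hPi] at hdv
  nlinarith

/-- **Pinsker's inequality.** -/
lemma tvDist_le_sqrt_klDiv {P Q : Measure E} [IsProbabilityMeasure P]
    [IsProbabilityMeasure Q] (hfin : klDiv P Q ≠ ∞) :
    tvDist P Q ≤ Real.sqrt ((klDiv P Q).toReal / 2) := by
  have : Nonempty {s : Set E // MeasurableSet s} := ⟨⟨∅, MeasurableSet.empty⟩⟩
  refine ciSup_le fun A => Real.abs_le_sqrt ?_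
  have := two_mul_sq_measureReal_sub_le_klDiv hfin A.2
  linarith

end Pinsker

/-! ### Hoeffding concentration of the empirical moment. -/

section Concentration

variable {Ω : Type*} [MeasurableSpace Ω] {Pr : Measure Ω} [IsProbabilityMeasure Pr]

/-- The one-sided Hoeffding inequality for independent variables with a common mean. -/
lemma measureReal_le_sum_sub_le {m : ℕ} {W : Fin m → Ω → ℝ} (hW : iIndepFun W Pr)
    (hWm : ∀ j, Measurable (W j)) {R : ℝ} (hR : 0 < R) (hWR : ∀ j ω, |W j ω| ≤ R)
    {c : ℝ} (hc : ∀ j, ∫ ω, W j ω ∂Pr = c) {ε : ℝ} (hε : 0 ≤ ε) :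
    Pr.real {ω | ε ≤ ∑ j, (W j ω - c)} ≤ Real.exp (-ε ^ 2 / (2 * (m * R ^ 2))) := by
  have hind : iIndepFun (fun j ω => W j ω - c) Pr :=
    hW.comp (fun _ y => y - c) fun _ => measurable_id.sub_const c
  have hsub : ∀ j ∈ Finset.univ, HasSubgaussianMGF (fun ω => W j ω - c)
      ((‖R - -R‖₊ / 2) ^ 2) Pr := fun j _ => by
    rw [← hc j]
    exact hasSubgaussianMGF_of_mem_Icc (hWm j).aemeasurable
      (ae_of_all _ fun ω => abs_le.1 (hWR j ω))
  refine (HasSubgaussianMGF.measure_sum_ge_le_of_iIndepFun hind hsub hε).trans (le_of_eq ?_)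
  congr 3
  simp only [sub_neg_eq_add, Finset.sum_const, Finset.card_univ, Fintype.card_fin, nsmul_eq_mul,
    NNReal.coe_mul, NNReal.coe_natCast, NNReal.coe_pow, NNReal.coe_div, coe_nnnorm,
    NNReal.coe_ofNat]
  rw [Real.norm_of_nonneg (by linarith)]
  ring

lemma norm_le_sqrt_mul_of_forall_abs_le {k : ℕ} {v : Feat k} {τ : ℝ} (hτ : 0 ≤ τ)
    (hv : ∀ i, |v i| ≤ τ) : ‖v‖ ≤ Real.sqrt k * τ := by
  rw [EuclideanSpace.norm_eq, ← Real.sqrt_sq hτ, ← Real.sqrt_mul (Nat.cast_nonneg k)]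
  refine Real.sqrt_le_sqrt ?_
  calc ∑ i, ‖v i‖ ^ 2 ≤ ∑ _i : Fin k, τ ^ 2 :=
        Finset.sum_le_sum fun i _ => pow_le_pow_left₀ (norm_nonneg _) (hv i) 2
    _ = k * τ ^ 2 := by simp

/-- Concentration of the empirical moment of bounded features in Euclidean norm. -/
lemma one_sub_le_measureReal_norm_empMoment_sub_le {E : Type*} [MeasurableSpace E]
    {Q : Measure E} [IsProbabilityMeasure Q] {k m : ℕ} (hm : 0 < m) {Z : Fin m → Ω → E}
    (hZm : ∀ j, Measurable (Z j)) (hZlaw : ∀ j, Pr.map (Z j) = Q) (hZind : iIndepFun Z Pr)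
    {Φ : E → Feat k} (hΦ : Measurable Φ) {R : ℝ} (hR : 0 < R) (hΦR : ∀ x, ‖Φ x‖ ≤ R)
    {δ : ℝ} (hδ : δ ∈ Set.Ioo (0 : ℝ) 1) :
    1 - δ ≤ Pr.real {ω | ‖empMoment Φ (fun j => Z j ω) - ∫ x, Φ x ∂Q‖ ≤ betaRate R k m δ} := by
  set S : Set Ω := {ω | ‖empMoment Φ (fun j => Z j ω) - ∫ x, Φ x ∂Q‖ ≤ betaRate R k m δ} with hS
  -- For `k = 0` the feature space is a point; otherwise `k ≥ 1` ensures `log(2k/δ) ≥ 0`.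
  rcases k.eq_zero_or_pos with rfl | hk
  · have hSu : S = Set.univ := Set.eq_univ_of_forall fun ω => by
      have h0 : empMoment Φ (fun j => Z j ω) - ∫ x, Φ x ∂Q = 0 := Subsingleton.elim _ _
      simp only [hS, Set.mem_ofPred_eq, h0, norm_zero]
      exact mul_nonneg hR.le (Real.sqrt_nonneg _)
    rw [hSu, probReal_univ]
    linarith [hδ.1]
  have hk' : (1 : ℝ) ≤ k := by exact_mod_cast hk
  have hm' : (0 : ℝ) < m := by exact_mod_cast hm
  set ℓ := Real.log (2 * k / δ) with hℓ
  have hℓ0 : 0 ≤ ℓ := Real.log_nonneg (by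
    rw [le_div_iff₀ hδ.1]
    linarith [hδ.2])
  -- Coordinatewise threshold: each of the `2k` one-sided tails is at most `δ/(2k)`, and passing to
  -- the Euclidean norm costs `√k`.
  set τ := R * Real.sqrt (2 * ℓ / m) with hτ
  have hτ0 : 0 ≤ τ := mul_nonneg hR.le (Real.sqrt_nonneg _)
  have hβ : betaRate R k m δ = Real.sqrt k * τ := by
    rw [betaRate, hτ, mul_left_comm, ← Real.sqrt_mul (Nat.cast_nonneg k), ← hℓ]
    congr 2
    ring
  have hexp : Real.exp (-(m * τ) ^ 2 / (2 * (m * R ^ 2))) = δ / (2 * k) := by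
    have h1 : -(m * τ) ^ 2 / (2 * (m * R ^ 2)) = -ℓ := by
      rw [hτ, mul_pow, mul_pow, Real.sq_sqrt (by positivity)]
      field_simp
    rw [h1, Real.exp_neg, hℓ, Real.exp_log (div_pos (by linarith) hδ.1), inv_div]
  set μ := ∫ x, Φ x ∂Q with hμ
  have hproj : ∀ i, Measurable fun x => Φ x i := fun i => by fun_prop
  have hmean : ∀ (i : Fin k) (j : Fin m), ∫ ω, Φ (Z j ω) i ∂Pr = μ i := fun i j => by
    have h1 : ∫ x, Φ x i ∂Q = μ i :=
      (EuclideanSpace.proj (𝕜 := ℝ) i).integral_comp_comm (integrable_features Q hΦ hΦR)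
    rw [← h1, ← hZlaw j, integral_map (hZm j).aemeasurable (hproj i).aestronglyMeasurable]
  have hbd : ∀ (i : Fin k) x, |Φ x i| ≤ R := fun i x =>
    (PiLp.norm_apply_le (Φ x) i).trans (hΦR x)
  have hindep : ∀ i : Fin k, iIndepFun (fun j ω => Φ (Z j ω) i) Pr := fun i =>
    hZind.comp (fun _ x => Φ x i) fun _ => hproj i
  set U : Fin k → Set Ω := fun i => {ω | m * τ ≤ ∑ j, (Φ (Z j ω) i - μ i)}
  set V : Fin k → Set Ω := fun i => {ω | m * τ ≤ ∑ j, (-Φ (Z j ω) i - -μ i)}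
  have hU : ∀ i, Pr.real (U i) ≤ δ / (2 * k) := fun i => by
    rw [← hexp]
    exact measureReal_le_sum_sub_le (hindep i) (fun j => (hproj i).comp (hZm j)) hR
      (fun j ω => hbd i _) (hmean i) (by positivity)
  have hV : ∀ i, Pr.real (V i) ≤ δ / (2 * k) := fun i => by
    rw [← hexp]
    refine measureReal_le_sum_sub_le (W := fun j ω => -Φ (Z j ω) i)
      ((hindep i).comp (fun _ y => -y) fun _ => measurable_neg)
      (fun j => ((hproj i).comp (hZm j)).neg) hR
      (fun j ω => by rw [abs_neg]; exact hbd i _) (fun j => ?_) (by positivity)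
    rw [integral_neg, hmean]
  have hcover : Set.univ ⊆ S ∪ ⋃ i ∈ (Finset.univ : Finset (Fin k)), (U i ∪ V i) := by
    intro ω _
    by_contra hω
    simp only [Set.mem_union, Set.mem_iUnion, Finset.mem_univ, exists_true_left, not_or,
      not_exists] at hω
    refine hω.1 ?_
    simp only [hS, Set.mem_ofPred_eq, hβ]
    refine norm_le_sqrt_mul_of_forall_abs_le hτ0 fun i => ?_
    have h1 : ∑ j, (Φ (Z j ω) i - μ i) < m * τ := not_le.1 (hω.2 i).1
    have h2 : ∑ j, (-Φ (Z j ω) i - -μ i) < m * τ := not_le.1 (hω.2 i).2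
    have h3 : (m : ℝ) * (empMoment Φ (fun j => Z j ω) - μ) i = ∑ j, (Φ (Z j ω) i - μ i) := by
      simp [empMoment, Finset.sum_sub_distrib, mul_sub, hm'.ne']
    have h4 : ∑ j, (-Φ (Z j ω) i - -μ i) = -∑ j, (Φ (Z j ω) i - μ i) := by
      rw [← Finset.sum_neg_distrib]
      exact Finset.sum_congr rfl fun j _ => by ring
    rw [← h3] at h1
    rw [h4, ← h3] at h2
    rw [abs_le]
    constructor
    · nlinarith
    · nlinarith
  have hsum : Pr.real (⋃ i ∈ (Finset.univ : Finset (Fin k)), (U i ∪ V i)) ≤ δ := by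
    refine (measureReal_biUnion_finset_le _ _).trans ?_
    calc ∑ i : Fin k, Pr.real (U i ∪ V i) ≤ ∑ _i : Fin k, δ / k :=
          Finset.sum_le_sum fun i _ => (measureReal_union_le _ _).trans
            ((add_le_add (hU i) (hV i)).trans (le_of_eq (by field_simp; ring)))
      _ = δ := by
        rw [Finset.sum_const, Finset.card_univ, Fintype.card_fin, nsmul_eq_mul]
        field_simp
  have h1 : Pr.real Set.univ ≤ _ := measureReal_mono hcover
  have h2 := measureReal_union_le (μ := Pr) S
    (⋃ i ∈ (Finset.univ : Finset (Fin k)), (U i ∪ V i))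
  rw [probReal_univ] at h1
  linarith

end Concentration

/-! ### Empirical measures and measurability of the uniform gradient deviation. -/

section EmpiricalMeasure

variable {E : Type*} [MeasurableSpace E] {n : ℕ}

lemma isProbabilityMeasure_empMeasure (hn : 0 < n) (x : Fin n → E) :
    IsProbabilityMeasure (empMeasure x) := by
  refine ⟨?_⟩
  rw [empMeasure, Measure.smul_apply, Measure.finsetSum_apply]
  simp only [measure_univ, Finset.sum_const, Finset.card_univ, Fintype.card_fin, nsmul_eq_mul,
    mul_one, smul_eq_mul]
  exact ENNReal.inv_mul_cancel (by exact_mod_cast hn.ne') (ENNReal.natCast_ne_top n)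

lemma integral_empMeasure {F : Type*} [NormedAddCommGroup F] [NormedSpace ℝ F] [CompleteSpace F]
    (x : Fin n → E) {f : E → F} (hf : StronglyMeasurable f) :
    ∫ y, f y ∂(empMeasure x) = (n : ℝ)⁻¹ • ∑ i, f (x i) := by
  rw [empMeasure, integral_smul_measure, integral_finsetSum_measure]
  · simp [integral_dirac' _ _ hf]
  · exact fun i _ => integrable_dirac' hf (by simp)

variable {k : ℕ} {Φ : E → Feat k} {R : ℝ}

/-- The explicit softmax average makes continuity in `ξ` and measurability in the sample visible. -/
lemma gradient_logPartition_empMeasure (hn : 0 < n) (hΦ : Measurable Φ)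
    (hR : ∀ x, ‖Φ x‖ ≤ R) (x : Fin n → E) (ξ : Feat k) :
    gradient (logPartition (empMeasure x) Φ) ξ
      = (∑ i, Real.exp ⟪ξ, Φ (x i)⟫)⁻¹ • ∑ i, Real.exp ⟪ξ, Φ (x i)⟫ • Φ (x i) := by
  have := isProbabilityMeasure_empMeasure hn x
  have hn' : (n : ℝ) ≠ 0 := by exact_mod_cast hn.ne'
  have he : Measurable fun y => Real.exp ⟪ξ, Φ y⟫ := (hΦ.const_inner (c := ξ)).exp
  rw [gradient_logPartition _ hΦ hR, expFamily, integral_tilted,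
    integral_empMeasure x (Measurable.stronglyMeasurable (by fun_prop)),
    integral_empMeasure x he.stronglyMeasurable, Finset.smul_sum,
    Finset.smul_sum (r := (∑ i, Real.exp ⟪ξ, Φ (x i)⟫)⁻¹)]
  refine Finset.sum_congr rfl fun i _ => ?_
  rw [smul_smul, smul_smul]
  congr 1
  simp only [smul_eq_mul]
  field_simp

/-- Both gradients are continuous on `Ξ`, so the uncountable supremum may be tested on a countable
dense subset. -/
lemma measurableSet_iSup_gradient_deviation_le {Ω : Type*} [MeasurableSpace Ω] (hn : 0 < n)
    (hΦ : Measurable Φ) (hR : ∀ x, ‖Φ x‖ ≤ R) {X : Fin n → Ω → E} (hX : ∀ i, Measurable (X i))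
    {Ξ : Set (Feat k)} {g : Feat k → Feat k} (hg : ContinuousOn g Ξ) (a : ℝ≥0∞) :
    MeasurableSet {ω | (⨆ ξ ∈ Ξ,
      ‖g ξ - gradient (logPartition (empMeasure (fun i => X i ω)) Φ) ξ‖ₑ) ≤ a} := by
  obtain ⟨S, hSΞ, hSc, hSd⟩ :=
    (TopologicalSpace.IsSeparable.of_separableSpace Ξ).exists_countable_dense_subset
  have heq : {ω | (⨆ ξ ∈ Ξ,
      ‖g ξ - gradient (logPartition (empMeasure (fun i => X i ω)) Φ) ξ‖ₑ) ≤ a}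
      = ⋂ ξ ∈ S, {ω | ‖g ξ
        - gradient (logPartition (empMeasure (fun i => X i ω)) Φ) ξ‖ₑ ≤ a} := by
    ext ω
    simp only [Set.mem_ofPred_eq, iSup_le_iff, Set.mem_iInter]
    refine ⟨fun h ξ hξ => h ξ (hSΞ hξ), fun h ξ hξ => ?_⟩
    refine ContinuousWithinAt.closure_le (hSd hξ)
      (f := fun ξ => ‖g ξ - gradient (logPartition (empMeasure (fun i => X i ω)) Φ) ξ‖ₑ)
      (g := fun _ => a) ?_ continuousWithinAt_const h
    refine ContinuousWithinAt.enorm (ContinuousWithinAt.sub ((hg ξ hξ).mono hSΞ) ?_)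
    rw [funext (gradient_logPartition_empMeasure hn hΦ hR fun i => X i ω)]
    have : Nonempty (Fin n) := ⟨⟨0, hn⟩⟩
    have hpos : ∀ η : Feat k, ∑ i, Real.exp ⟪η, Φ (X i ω)⟫ ≠ 0 := fun η =>
      (Finset.sum_pos (fun i _ => Real.exp_pos _) Finset.univ_nonempty).ne'
    exact Continuous.continuousWithinAt (by fun_prop (disch := exact hpos))
  rw [heq]
  refine MeasurableSet.biInter hSc fun ξ _ => measurableSet_le ?_ measurable_const
  simp_rw [gradient_logPartition_empMeasure hn hΦ hR]
  have h1 : ∀ i, Measurable fun ω => Φ (X i ω) := fun i => hΦ.comp (hX i)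
  have h2 : ∀ i, Measurable fun ω => Real.exp ⟪ξ, Φ (X i ω)⟫ := fun i =>
    ((h1 i).const_inner (c := ξ)).exp
  fun_prop

end EmpiricalMeasure

/-! ### Couplings of reweighted measures. -/

section Transport

lemma map_withDensity_comp {α β : Type*} [MeasurableSpace α] [MeasurableSpace β] {π : Measure α}
    {φ : α → β} (hφ : Measurable φ) {p : β → ℝ≥0∞} (hp : Measurable p) :
    (π.withDensity (p ∘ φ)).map φ = (π.map φ).withDensity p := by
  ext s hs
  rw [Measure.map_apply hφ hs, withDensity_apply _ (hφ hs), withDensity_apply _ hs,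
    setLIntegral_map hs hp hφ]
  rfl

/-- Marginal bookkeeping for the coupling below: the moved part `g` and the residual `p ∘ φ - g`
together restore the density `p`. -/
lemma map_withDensity_add_map_withDensity_sub {α β : Type*} [MeasurableSpace α]
    [MeasurableSpace β] {π : Measure α} {φ : α → β} (hφ : Measurable φ) {p : β → ℝ≥0∞}
    (hp : Measurable p) {g : α → ℝ≥0∞} (hg : Measurable g) (hgp : ∀ z, g z ≤ p (φ z)) :
    (π.withDensity g).map φ + (π.withDensity fun z => p (φ z) - g z).map φ
      = (π.map φ).withDensity p := by
  rw [← Measure.map_add _ _ hφ, ← withDensity_add_left hg, ← map_withDensity_comp hφ hp]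
  congr 2
  ext z
  exact add_tsub_cancel_of_le (hgp z)

variable {E : Type*} [MetricSpace E] [MeasurableSpace E]

lemma W1_le_lintegral {μ ν : Measure E} {π : Measure (E × E)} (h1 : π.map Prod.fst = μ)
    (h2 : π.map Prod.snd = ν) : W1 μ ν ≤ ∫⁻ p, edist p.1 p.2 ∂π :=
  iInf_le_of_le π (iInf_le_of_le h1 (iInf_le _ h2))

/-- A coupling of two measures induces a coupling of two reweighted measures: the part `g` of the
mass moves along the original coupling, the rest is coupled independently. -/
lemma W1_withDensity_le {π : Measure (E × E)} {p q : E → ℝ≥0∞} (hp : Measurable p)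
    (hq : Measurable q) (hp1 : ∫⁻ x, p x ∂(π.map Prod.fst) = 1)
    (hq1 : ∫⁻ y, q y ∂(π.map Prod.snd) = 1) {g : E × E → ℝ≥0∞} (hg : Measurable g)
    (hgp : ∀ z, g z ≤ p z.1) (hgq : ∀ z, g z ≤ q z.2) {K : ℝ≥0∞} (hK : ∀ z, g z ≤ K)
    {D : ℝ≥0∞} (hD : ∀ x y : E, edist x y ≤ D) :
    W1 ((π.map Prod.fst).withDensity p) ((π.map Prod.snd).withDensity q)
      ≤ K * ∫⁻ z, edist z.1 z.2 ∂π + D * ∫⁻ z, (p z.1 - g z) ∂π := by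
  have hp1' : ∫⁻ z, p z.1 ∂π = 1 := by rw [← hp1, lintegral_map hp measurable_fst]
  have hq1' : ∫⁻ z, q z.2 ∂π = 1 := by rw [← hq1, lintegral_map hq measurable_snd]
  have hgfin : ∫⁻ z, g z ∂π ≠ ∞ :=
    ne_top_of_le_ne_top ENNReal.one_ne_top (hp1' ▸ lintegral_mono hgp)
  -- Both densities have total mass one, so the two residuals share the mass `r`, as needed for `r⁻¹
  -- • κ₁.prod κ₂` to have marginals `κ₁` and `κ₂`.
  set r := ∫⁻ z, (p z.1 - g z) ∂π with hr
  have hr1 : r = 1 - ∫⁻ z, g z ∂π := by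
    rw [hr, lintegral_sub hg hgfin (ae_of_all _ hgp), hp1']
  have hr2 : ∫⁻ z, (q z.2 - g z) ∂π = r := by
    rw [lintegral_sub hg hgfin (ae_of_all _ hgq), hq1', hr1]
  have hrtop : r ≠ ∞ := hr1 ▸ ne_top_of_le_ne_top ENNReal.one_ne_top tsub_le_self
  set κ₁ := (π.withDensity fun z => p z.1 - g z).map Prod.fst with hκ₁
  set κ₂ := (π.withDensity fun z => q z.2 - g z).map Prod.snd with hκ₂
  have hu1 : κ₁ Set.univ = r := by
    rw [hκ₁, Measure.map_apply measurable_fst MeasurableSet.univ, Set.preimage_univ,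
      withDensity_apply _ MeasurableSet.univ, setLIntegral_univ]
  have hu2 : κ₂ Set.univ = r := by
    rw [hκ₂, Measure.map_apply measurable_snd MeasurableSet.univ, Set.preimage_univ,
      withDensity_apply _ MeasurableSet.univ, setLIntegral_univ, hr2]
  have : IsFiniteMeasure κ₁ := ⟨by rw [hu1]; exact hrtop.lt_top⟩
  have : IsFiniteMeasure κ₂ := ⟨by rw [hu2]; exact hrtop.lt_top⟩
  -- If `r = 0` then `r⁻¹ = ∞`, but the residuals vanish and the formula survives.
  have hcancel : ∀ κ : Measure E, κ Set.univ = r → r⁻¹ • (r • κ) = κ := fun κ hκ => by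
    rcases eq_or_ne r 0 with h0 | h0
    · rw [h0] at hκ
      rw [Measure.measure_univ_eq_zero.1 hκ]
      simp
    · rw [smul_smul, ENNReal.inv_mul_cancel h0 hrtop, one_smul]
  have hfst : (π.withDensity g + r⁻¹ • κ₁.prod κ₂).map Prod.fst
      = (π.map Prod.fst).withDensity p := by
    rw [Measure.map_add _ _ measurable_fst, Measure.map_smul, Measure.map_fst_prod, hu2,
      hcancel κ₁ hu1]
    exact map_withDensity_add_map_withDensity_sub measurable_fst hp hg hgp
  have hsnd : (π.withDensity g + r⁻¹ • κ₁.prod κ₂).map Prod.snd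
      = (π.map Prod.snd).withDensity q := by
    rw [Measure.map_add _ _ measurable_snd, Measure.map_smul, Measure.map_snd_prod, hu1,
      hcancel κ₂ hu2]
    exact map_withDensity_add_map_withDensity_sub measurable_snd hq hg hgq
  refine (W1_le_lintegral hfst hsnd).trans ?_
  rw [lintegral_add_measure, lintegral_smul_measure]
  refine add_le_add ?_ ?_
  · have hle : π.withDensity g ≤ K • π := by
      rw [← withDensity_const]
      exact withDensity_mono (ae_of_all _ hK)
    refine (lintegral_mono' hle le_rfl).trans ?_
    rw [lintegral_smul_measure, smul_eq_mul]
  · calc r⁻¹ • ∫⁻ z, edist z.1 z.2 ∂(κ₁.prod κ₂)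
        ≤ r⁻¹ * ∫⁻ _, D ∂(κ₁.prod κ₂) := by
          rw [smul_eq_mul]
          gcongr
          exact hD _ _
      _ = D * (r⁻¹ * r * r) := by
          rw [lintegral_const, ← Set.univ_prod_univ, Measure.prod_prod, hu1, hu2]
          ring
      _ ≤ D * r := by
          gcongr
          exact mul_le_of_le_one_left zero_le (ENNReal.inv_mul_le_one r)

end Transport

/-! ### Residual mass and total variation. -/

section TotalVariation

variable {E : Type*} [MeasurableSpace E]

/-- The truncated difference lives on `{q < p}`, where its integral is a difference of measures of
one admissible set. -/
lemma lintegral_sub_le_tvDist {μ : Measure E} {p q : E → ℝ≥0∞} (hp : Measurable p)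
    (hq : Measurable q) [IsProbabilityMeasure (μ.withDensity p)]
    [IsProbabilityMeasure (μ.withDensity q)] :
    ∫⁻ x, (p x - q x) ∂μ ≤ ENNReal.ofReal (tvDist (μ.withDensity p) (μ.withDensity q)) := by
  set A : Set E := {x | q x < p x} with hA
  have hAm : MeasurableSet A := measurableSet_lt hq hp
  have hcompl : ∫⁻ x in Aᶜ, (p x - q x) ∂μ = 0 := by
    rw [setLIntegral_congr_fun hAm.compl (g := fun _ => 0)
      fun x hx => tsub_eq_zero_of_le (not_lt.1 hx), lintegral_zero]
  have hqA : ∫⁻ x in A, q x ∂μ ≠ ∞ := by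
    rw [← withDensity_apply _ hAm]
    exact measure_ne_top _ _
  rw [← lintegral_add_compl _ hAm, hcompl, add_zero, lintegral_sub hq hqA
    ((ae_restrict_iff' hAm).2 (ae_of_all _ fun x (hx : q x < p x) => hx.le)),
    ← withDensity_apply _ hAm, ← withDensity_apply _ hAm,
    ← ENNReal.ofReal_toReal (measure_ne_top (μ.withDensity p) A),
    ← ENNReal.ofReal_toReal (measure_ne_top (μ.withDensity q) A),
    ← ENNReal.ofReal_sub _ ENNReal.toReal_nonneg]
  exact ENNReal.ofReal_le_ofReal (measureReal_sub_le_tvDist _ _ hAm)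

end TotalVariation

/-! ### Wasserstein stability of exponential families. -/

section Stability

variable {E : Type*} [MetricSpace E] {k : ℕ} {Φ : E → Feat k} {R B : ℝ} {LΦ : ℝ≥0}

lemma exp_sub_exp_le_mul_abs {a b M : ℝ} (ha : a ≤ M) :
    Real.exp a - Real.exp b ≤ Real.exp M * |a - b| := by
  have h1 := Real.add_one_le_exp (b - a)
  have h2 : Real.exp b = Real.exp a * Real.exp (b - a) := by
    rw [← Real.exp_add]
    ring_nf
  calc Real.exp a - Real.exp b ≤ Real.exp a * (a - b) := by
        rw [h2]
        nlinarith [Real.exp_pos a]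
    _ ≤ Real.exp a * |a - b| := mul_le_mul_of_nonneg_left (le_abs_self _) (Real.exp_pos _).le
    _ ≤ Real.exp M * |a - b| :=
        mul_le_mul_of_nonneg_right (Real.exp_le_exp.2 ha) (abs_nonneg _)

lemma abs_exp_inner_sub_exp_inner_le (hR0 : 0 ≤ R) (hR : ∀ x, ‖Φ x‖ ≤ R)
    (hL : LipschitzWith LΦ Φ) {ξ : Feat k} (hξ : ‖ξ‖ ≤ B) (x y : E) :
    |Real.exp ⟪ξ, Φ x⟫ - Real.exp ⟪ξ, Φ y⟫| ≤ B * LΦ * Real.exp (B * R) * dist x y := by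
  have hle : ∀ x, ⟪ξ, Φ x⟫ ≤ B * R := fun x =>
    (abs_le.1 (abs_inner_le_of_norm_le hR ξ x)).2.trans (mul_le_mul_of_nonneg_right hξ hR0)
  have hdiff : |⟪ξ, Φ x⟫ - ⟪ξ, Φ y⟫| ≤ B * (LΦ * dist x y) := by
    rw [← inner_sub_right]
    refine (abs_real_inner_le_norm _ _).trans (mul_le_mul hξ ?_ (norm_nonneg _)
      ((norm_nonneg _).trans hξ))
    rw [← dist_eq_norm]
    exact hL.dist_le_mul x y
  have h : Real.exp (B * R) * |⟪ξ, Φ x⟫ - ⟪ξ, Φ y⟫| ≤ B * LΦ * Real.exp (B * R) * dist x y := by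
    refine (mul_le_mul_of_nonneg_left hdiff (Real.exp_pos _).le).trans (le_of_eq ?_)
    ring
  refine abs_le.2 ⟨?_, (exp_sub_exp_le_mul_abs (hle x)).trans h⟩
  have h2 := exp_sub_exp_le_mul_abs (b := ⟪ξ, Φ x⟫) (hle y)
  rw [abs_sub_comm] at h2
  linarith

variable [MeasurableSpace E]

/-- Weights that are Lipschitz and bounded below stay close, after normalization, along a
coupling. -/
lemma lintegral_normalized_sub_le {π : Measure (E × E)} [IsProbabilityMeasure π] {w : E → ℝ}
    (hw : Measurable w) {m M ℓ : ℝ} (hm : 0 < m) (hmw : ∀ x, m ≤ w x) (hwM : ∀ x, w x ≤ M)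
    (hℓ : 0 ≤ ℓ) (hwl : ∀ x y, |w x - w y| ≤ ℓ * dist x y) :
    ∫⁻ z, (ENNReal.ofReal (w z.1 / ∫ x, w x ∂(π.map Prod.fst))
        - ENNReal.ofReal (w z.2 / ∫ x, w x ∂(π.map Prod.snd))) ∂π
      ≤ ENNReal.ofReal (2 * (ℓ / m)) * ∫⁻ z, edist z.1 z.2 ∂π := by
  set c := ∫⁻ z, edist z.1 z.2 ∂π
  have hint : ∀ {φ : E × E → E}, Measurable φ → Integrable (fun z => w (φ z)) π := fun hφ =>
    Integrable.of_mem_Icc m M (hw.comp hφ).aemeasurable (ae_of_all _ fun z => ⟨hmw _, hwM _⟩)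
  have hA : ∫ x, w x ∂(π.map Prod.fst) = ∫ z, w z.1 ∂π :=
    integral_map measurable_fst.aemeasurable hw.aestronglyMeasurable
  have hB : ∫ x, w x ∂(π.map Prod.snd) = ∫ z, w z.2 ∂π :=
    integral_map measurable_snd.aemeasurable hw.aestronglyMeasurable
  rw [hA, hB]
  set A := ∫ z, w z.1 ∂π with hAdef
  set B := ∫ z, w z.2 ∂π with hBdef
  have hmA : m ≤ A := by
    have := integral_mono (μ := π) (integrable_const m) (hint measurable_fst) fun z => hmw z.1
    simpa using this
  have hmB : m ≤ B := by
    have := integral_mono (μ := π) (integrable_const m) (hint measurable_snd) fun z => hmw z.2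
    simpa using this
  have hA0 : 0 < A := hm.trans_le hmA
  have hB0 : 0 < B := hm.trans_le hmB
  have hdiff : ENNReal.ofReal |B - A| ≤ ENNReal.ofReal ℓ * c := by
    rw [hBdef, hAdef, ← integral_sub (hint measurable_snd) (hint measurable_fst),
      ← Real.norm_eq_abs, ofReal_norm, ← lintegral_const_mul' _ _ ENNReal.ofReal_ne_top]
    refine (enorm_integral_le_lintegral_enorm _).trans (lintegral_mono fun z => ?_)
    rw [← ofReal_norm, Real.norm_eq_abs, edist_dist, ← ENNReal.ofReal_mul hℓ, abs_sub_comm]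
    exact ENNReal.ofReal_le_ofReal (hwl _ _)
  have hpt : ∀ z : E × E, ENNReal.ofReal (w z.1 / A) - ENNReal.ofReal (w z.2 / B)
      ≤ ENNReal.ofReal (ℓ / m) * edist z.1 z.2
        + ENNReal.ofReal (w z.2 / B) * ENNReal.ofReal (|B - A| / m) := fun z => by
    have hw2 : 0 ≤ w z.2 / B := div_nonneg (hm.le.trans (hmw _)) hB0.le
    rw [← ENNReal.ofReal_sub _ hw2, edist_dist, ← ENNReal.ofReal_mul (by positivity),
      ← ENNReal.ofReal_mul hw2, ← ENNReal.ofReal_add (by positivity) (by positivity)]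
    refine ENNReal.ofReal_le_ofReal ?_
    -- In this splitting `w/B` has integral one, so after integration each term costs `ℓ/m`; this is
    -- the factor 2, with no extra `M/m`.
    have e : w z.1 / A - w z.2 / B = (w z.1 - w z.2) / A + w z.2 / B * ((B - A) / A) := by
      field_simp
      ring
    have h1 : (w z.1 - w z.2) / A ≤ ℓ / m * dist z.1 z.2 := by
      calc (w z.1 - w z.2) / A ≤ ℓ * dist z.1 z.2 / A := by
            gcongr
            exact (le_abs_self _).trans (hwl _ _)
        _ ≤ ℓ * dist z.1 z.2 / m := by gcongr
        _ = ℓ / m * dist z.1 z.2 := by ring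
    have h2 : (B - A) / A ≤ |B - A| / m := by
      calc (B - A) / A ≤ |B - A| / A := by
            gcongr
            exact le_abs_self _
        _ ≤ |B - A| / m := by gcongr
    rw [e]
    exact add_le_add h1 (mul_le_mul_of_nonneg_left h2 hw2)
  have hnorm : ∫⁻ z, ENNReal.ofReal (w z.2 / B) ∂π = 1 := by
    rw [← ofReal_integral_eq_lintegral_ofReal ((hint measurable_snd).div_const B)
      (ae_of_all _ fun z => div_nonneg (hm.le.trans (hmw _)) hB0.le), integral_div,
      ← hBdef, div_self hB0.ne', ENNReal.ofReal_one]
  have hmeas : Measurable fun z : E × E => ENNReal.ofReal (w z.2 / B) :=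
    ((hw.comp measurable_snd).div_const B).ennreal_ofReal
  refine (lintegral_mono hpt).trans ?_
  rw [lintegral_add_right _ (hmeas.mul_const _), lintegral_mul_const _ hmeas, hnorm, one_mul,
    lintegral_const_mul' _ _ ENNReal.ofReal_ne_top, two_mul,
    ENNReal.ofReal_add (by positivity) (by positivity), add_mul]
  gcongr
  rw [div_eq_mul_inv, ENNReal.ofReal_mul (abs_nonneg _), div_eq_mul_inv, ENNReal.ofReal_mul hℓ,
    mul_right_comm]
  gcongr

variable [BorelSpace E]

/-- Stability of exponential families in Wasserstein distance, under a change of both the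
parameter and the reference measure. -/
lemma W1_expFamily_le {μ ν : Measure E} [IsProbabilityMeasure μ] [IsProbabilityMeasure ν]
    (hR0 : 0 ≤ R) (hR : ∀ x, ‖Φ x‖ ≤ R) (hL : LipschitzWith LΦ Φ) {D : ℝ} (hD0 : 0 ≤ D)
    (hD : ∀ x y : E, dist x y ≤ D) (ξ : Feat k) {η : Feat k} (hη : ‖η‖ ≤ B) :
    W1 (expFamily μ Φ ξ) (expFamily ν Φ η)
      ≤ ENNReal.ofReal (D * tvDist (expFamily μ Φ ξ) (expFamily μ Φ η))
        + ENNReal.ofReal (Real.exp (B * R) / Real.exp (-(B * R))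
            + D * (2 * (B * LΦ * Real.exp (B * R) / Real.exp (-(B * R))))) * W1 μ ν := by
  have hΦ : Measurable Φ := hL.continuous.measurable
  have hB0 : 0 ≤ B := (norm_nonneg _).trans hη
  set m := Real.exp (-(B * R)) with hm
  set M := Real.exp (B * R) with hM
  set ℓ := B * LΦ * M with hℓ
  have hm0 : 0 < m := Real.exp_pos _
  have hM0 : 0 < M := Real.exp_pos _
  have hℓ0 : 0 ≤ ℓ := by positivity
  have hηBR : ‖η‖ * R ≤ B * R := mul_le_mul_of_nonneg_right hη hR0
  set w : E → ℝ := fun x => Real.exp ⟪η, Φ x⟫ with hw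
  have hwM : ∀ x, w x ≤ M := fun x => (exp_inner_le hR η x).trans (Real.exp_le_exp.2 hηBR)
  have hmw : ∀ x, m ≤ w x := fun x =>
    (Real.exp_le_exp.2 (neg_le_neg hηBR)).trans (le_exp_inner hR η x)
  have hwl : ∀ x y, |w x - w y| ≤ ℓ * dist x y := abs_exp_inner_sub_exp_inner_le hR0 hR hL hη
  have hwm : Measurable w := (hΦ.const_inner (c := η)).exp
  have hpt : ∀ (ρ : Measure E) (ζ : Feat k),
      Measurable fun x => ENNReal.ofReal (Real.exp ⟪ζ, Φ x⟫ / ∫ x, Real.exp ⟪ζ, Φ x⟫ ∂ρ) :=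
    fun ρ ζ => ((hΦ.const_inner (c := ζ)).exp.div_const _).ennreal_ofReal
  have hone : ∀ (ρ : Measure E) [IsProbabilityMeasure ρ] (ζ : Feat k),
      ∫⁻ x, ENNReal.ofReal (Real.exp ⟪ζ, Φ x⟫ / ∫ x, Real.exp ⟪ζ, Φ x⟫ ∂ρ) ∂ρ = 1 :=
    fun ρ _ ζ => by
      have h := (isProbabilityMeasure_expFamily ρ hΦ hR ζ).measure_univ
      rwa [expFamily, tilted_apply' _ _ MeasurableSet.univ, setLIntegral_univ] at h
  have hDe : ∀ x y : E, edist x y ≤ ENNReal.ofReal D := fun x y => by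
    rw [edist_dist]
    exact ENNReal.ofReal_le_ofReal (hD x y)
  have h1 := isProbabilityMeasure_expFamily μ hΦ hR ξ
  have h2 := isProbabilityMeasure_expFamily μ hΦ hR η
  set T := tvDist (expFamily μ Φ ξ) (expFamily μ Φ η) with hT
  set C := M / m + D * (2 * (ℓ / m)) with hC
  have hC0 : 0 < C := by positivity
  -- The bound holds for every coupling, and the infimum is taken last, so no optimal coupling is
  -- required.
  have key : ∀ π : Measure (E × E), π.map Prod.fst = μ → π.map Prod.snd = ν →
      W1 (expFamily μ Φ ξ) (expFamily ν Φ η)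
        ≤ ENNReal.ofReal (D * T) + ENNReal.ofReal C * ∫⁻ z, edist z.1 z.2 ∂π := by
    intro π hπ1 hπ2
    have hπ : IsProbabilityMeasure π := by
      have : IsProbabilityMeasure (π.map Prod.fst) := hπ1 ▸ inferInstance
      exact Measure.isProbabilityMeasure_of_map Prod.fst
    set p₁ : E → ℝ≥0∞ := fun x =>
      ENNReal.ofReal (Real.exp ⟪ξ, Φ x⟫ / ∫ x, Real.exp ⟪ξ, Φ x⟫ ∂μ) with hp₁
    set p₂ : E → ℝ≥0∞ := fun x => ENNReal.ofReal (w x / ∫ x, w x ∂μ) with hp₂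
    set q : E → ℝ≥0∞ := fun x => ENNReal.ofReal (w x / ∫ x, w x ∂ν) with hq
    have hp₁m : Measurable p₁ := hpt μ ξ
    have hp₂m : Measurable p₂ := hpt μ η
    have hqm : Measurable q := hpt ν η
    have hp₂K : ∀ x, p₂ x ≤ ENNReal.ofReal (M / m) := fun x => by
      refine ENNReal.ofReal_le_ofReal (div_le_div₀ hM0.le (hwM x) hm0 ?_)
      have := integral_mono (μ := μ) (integrable_const m) (integrable_exp_inner μ hΦ hR η) hmw
      simpa using this
    -- Including the intermediate density `p₂` in the minimum bounds the moved mass by `M/m` using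
    -- only `‖η‖ ≤ B`, and separates the change of parameter from the change of reference measure.
    have hW := W1_withDensity_le (π := π) hp₁m hqm (by rw [hπ1]; exact hone μ ξ)
      (by rw [hπ2]; exact hone ν η) (g := fun z => min (p₁ z.1) (min (p₂ z.1) (q z.2)))
      ((hp₁m.comp measurable_fst).min ((hp₂m.comp measurable_fst).min (hqm.comp measurable_snd)))
      (fun z => min_le_left _ _) (fun z => (min_le_right _ _).trans (min_le_right _ _))
      (fun z => ((min_le_right _ _).trans (min_le_left _ _)).trans (hp₂K z.1)) hDe
    rw [hπ1, hπ2] at hW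
    have hsplit : ∀ z : E × E, p₁ z.1 - min (p₁ z.1) (min (p₂ z.1) (q z.2))
        ≤ (p₁ z.1 - p₂ z.1) + (p₂ z.1 - q z.2) := fun z => by
      rcases le_total (p₁ z.1) (min (p₂ z.1) (q z.2)) with h | h
      · simp [min_eq_left h]
      · rw [min_eq_right h]
        rcases le_total (p₂ z.1) (q z.2) with h' | h'
        · rw [min_eq_left h']
          exact le_self_add
        · rw [min_eq_right h']
          exact tsub_le_tsub_add_tsub
    have hres : ∫⁻ z, (p₁ z.1 - min (p₁ z.1) (min (p₂ z.1) (q z.2))) ∂π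
        ≤ ENNReal.ofReal T + ENNReal.ofReal (2 * (ℓ / m)) * ∫⁻ z, edist z.1 z.2 ∂π := by
      refine (lintegral_mono hsplit).trans ?_
      rw [lintegral_add_left (f := fun z : E × E => p₁ z.1 - p₂ z.1)
        ((hp₁m.comp measurable_fst).sub (hp₂m.comp measurable_fst))]
      refine add_le_add ?_ ?_
      · have h3 : IsProbabilityMeasure (μ.withDensity p₁) := h1
        have h4 : IsProbabilityMeasure (μ.withDensity p₂) := h2
        have h5 := lintegral_sub_le_tvDist (μ := μ) hp₁m hp₂m
        have h6 := lintegral_map (μ := π) (hp₁m.sub hp₂m) measurable_fst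
        rw [hπ1] at h6
        exact h6.symm.le.trans h5
      · have h3 := lintegral_normalized_sub_le (π := π) hwm hm0 hmw hwM hℓ0 hwl
        rwa [hπ1, hπ2] at h3
    refine hW.trans ((add_le_add le_rfl (mul_le_mul_right hres _)).trans (le_of_eq ?_))
    rw [mul_add, ← mul_assoc, ← ENNReal.ofReal_mul hD0, ← ENNReal.ofReal_mul hD0, hC,
      ENNReal.ofReal_add (by positivity) (by positivity), add_mul]
    ring
  -- A nonzero finite constant commutes with the infimum over couplings.
  have hCne : ENNReal.ofReal C ≠ 0 := by simpa using hC0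
  conv_rhs => rw [W1]
  simp_rw [ENNReal.mul_iInf_of_ne hCne ENNReal.ofReal_ne_top, ENNReal.add_iInf]
  exact le_iInf fun π => le_iInf fun h => le_iInf fun h' => key π h h'

end Stability

/-- One of the two terms `D L_w / m` is absorbed into `D M L_w / m²`, because `m ≤ M`. -/
lemma le_stabConst {k : ℕ} {Ξ : Set (Feat k)} {R LΦ D : ℝ} (hB : 0 ≤ normBound Ξ) (hR : 0 ≤ R)
    (hL : 0 ≤ LΦ) (hD : 0 ≤ D) :
    Real.exp (normBound Ξ * R) / Real.exp (-(normBound Ξ * R))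
      + D * (2 * (normBound Ξ * LΦ * Real.exp (normBound Ξ * R)
        / Real.exp (-(normBound Ξ * R)))) ≤ stabConst Ξ R LΦ D := by
  rw [stabConst, weightLip]
  have hBR : 0 ≤ normBound Ξ * R := mul_nonneg hB hR
  have hmM : Real.exp (-(normBound Ξ * R)) ≤ Real.exp (normBound Ξ * R) :=
    Real.exp_le_exp.2 (by linarith)
  have hm0 : 0 < Real.exp (-(normBound Ξ * R)) := Real.exp_pos _
  set m := Real.exp (-(normBound Ξ * R))
  set M := Real.exp (normBound Ξ * R)
  set ℓ := normBound Ξ * LΦ * M with hℓ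
  have hℓ0 : 0 ≤ ℓ := mul_nonneg (mul_nonneg hB hL) (hm0.le.trans hmM)
  have h : D * (ℓ / m) ≤ D * M * ℓ / m ^ 2 := by
    rw [show D * M * ℓ / m ^ 2 = D * (ℓ / m) * (M / m) by field_simp]
    exact le_mul_of_one_le_right (by positivity) ((one_le_div hm0).2 hmM)
  have e : M / m + D * (2 * (ℓ / m)) = (M + D * ℓ) / m + D * (ℓ / m) := by ring
  linarith

end EPA

/-! ### The finite-sample theorem. -/

theorem mainTheorem11
    {Ω : Type*} [MeasurableSpace Ω] (Pr : Measure Ω) [IsProbabilityMeasure Pr]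
    {E : Type*} [MetricSpace E] [MeasurableSpace E] [BorelSpace E]
    (PX QX : Measure E) [IsProbabilityMeasure PX] [IsProbabilityMeasure QX]
    {k n m : ℕ} (hn : 0 < n) (hm : 0 < m)
    -- the i.i.d. source and target samples
    (X : Fin n → Ω → E) (hXm : ∀ i, Measurable (X i)) (hXlaw : ∀ i, Pr.map (X i) = PX)
    (hXind : iIndepFun X Pr)
    (Z : Fin m → Ω → E) (hZm : ∀ j, Measurable (Z j)) (hZlaw : ∀ j, Pr.map (Z j) = QX)
    (hZind : iIndepFun Z Pr)
    -- bounded Lipschitz features on a space of finite diameter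
    (Φ : E → EPA.Feat k) (R : ℝ) (hR : 0 < R) (hΦR : ∀ x, ‖Φ x‖ ≤ R)
    (LΦ : ℝ≥0) (hΦL : LipschitzWith LΦ Φ)
    (D : ℝ) (hD : ∀ x y : E, dist x y ≤ D)
    -- the compact convex parameter set, on which `H` is strongly convex and smooth
    (Ξ : Set (EPA.Feat k)) (hΞne : Ξ.Nonempty) (hΞcpt : IsCompact Ξ) (hΞcvx : Convex ℝ Ξ)
    (σ L : ℝ) (hσ : 0 < σ) (hσL : σ ≤ L)
    (hstrong : StrongConvexOn Ξ σ (EPA.logPartition PX Φ))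
    (hsmooth : ∀ ξ ∈ Ξ, ∀ η ∈ Ξ,
      ‖gradient (EPA.logPartition PX Φ) ξ - gradient (EPA.logPartition PX Φ) η‖
        ≤ L * ‖ξ - η‖)
    -- the population solution and its dual parameter
    (Pstar : Measure E) (hPstar : EPA.IsIProjection PX Φ (∫ x, Φ x ∂QX) Pstar)
    (ξstar : EPA.Feat k) (hξstar : EPA.IsDualSolution PX Φ (∫ x, Φ x ∂QX) ξstar)
    (hξstarΞ : ξstar ∈ Ξ)
    -- uniform gradient concentration
    (α : ℝ → ℝ) (hαpos : ∀ δ ∈ Set.Ioo (0 : ℝ) 1, 0 < α δ)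
    (hα : ∀ δ ∈ Set.Ioo (0 : ℝ) 1,
      1 - δ ≤ Pr.real {ω | (⨆ ξ ∈ Ξ, ‖gradient (EPA.logPartition PX Φ) ξ
        - gradient (EPA.logPartition (EPA.empMeasure (fun i => X i ω)) Φ) ξ‖ₑ)
          ≤ ENNReal.ofReal (α δ)})
    (δ : ℝ) (hδ : δ ∈ Set.Ioo (0 : ℝ) 1) :
    -- the event on which the finite-sample bounds hold has probability at least `1 - 2δ`
    (∃ G : Set Ω, MeasurableSet G ∧ 1 - 2 * δ ≤ Pr.real G ∧
      G ⊆ EPA.boundsEvent PX Φ Ξ σ L (α δ) (EPA.betaRate R k m δ) ξstar Pstar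
        (fun ω i => X i ω) (fun ω j => Z j ω)) ∧
    -- and on this event the discrete solution satisfies the error decomposition
    ∀ ω ∈ EPA.boundsEvent PX Φ Ξ σ L (α δ) (EPA.betaRate R k m δ) ξstar Pstar
        (fun ω i => X i ω) (fun ω j => Z j ω),
      ∀ ξhat ∈ Ξ, EPA.IsDualSolution (EPA.empMeasure (fun i => X i ω)) Φ
          (EPA.empMoment Φ (fun j => Z j ω)) ξhat →
      ∀ Phat : Measure E, EPA.IsIProjection (EPA.empMeasure (fun i => X i ω)) Φ
          (EPA.empMoment Φ (fun j => Z j ω)) Phat →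
        EPA.W1 Pstar Phat
          ≤ ENNReal.ofReal (D * Real.sqrt L / (2 * σ) * (α δ + EPA.betaRate R k m δ))
            + ENNReal.ofReal (EPA.stabConst Ξ R LΦ D)
              * EPA.W1 PX (EPA.empMeasure (fun i => X i ω)) := by
  have hΦ : Measurable Φ := hΦL.continuous.measurable
  have hE : Nonempty E := nonempty_of_isProbabilityMeasure PX
  have hD0 : 0 ≤ D := by
    obtain ⟨x⟩ := hE
    simpa using hD x x
  have hL0 : 0 < L := hσ.trans_le hσL
  have hgrad : ∀ ξ, HasGradientAt (EPA.logPartition PX Φ)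
      (gradient (EPA.logPartition PX Φ) ξ) ξ := fun ξ =>
    (EPA.hasGradientAt_logPartition PX hΦ hΦR ξ).differentiableAt.hasGradientAt
  have hP : Pstar = EPA.expFamily PX Φ ξstar := hPstar.eq_expFamily hΦ hΦR hξstar
  have hgstar := hξstar.gradient_eq hΦ hΦR
  have hcont : ContinuousOn (gradient (EPA.logPartition PX Φ)) Ξ :=
    (LipschitzOnWith.of_dist_le_mul (K := ⟨L, hL0.le⟩) fun ξ hξ η hη => by
      rw [dist_eq_norm, dist_eq_norm]
      exact hsmooth ξ hξ η hη).continuousOn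
  refine ⟨?_, ?_⟩
  · set S₁ : Set Ω := {ω | (⨆ ξ ∈ Ξ, ‖gradient (EPA.logPartition PX Φ) ξ
        - gradient (EPA.logPartition (EPA.empMeasure (fun i => X i ω)) Φ) ξ‖ₑ)
          ≤ ENNReal.ofReal (α δ)} with hS₁
    set S₂ : Set Ω := {ω | ‖EPA.empMoment Φ (fun j => Z j ω) - ∫ x, Φ x ∂QX‖
      ≤ EPA.betaRate R k m δ} with hS₂
    have hm₁ : MeasurableSet S₁ :=
      EPA.measurableSet_iSup_gradient_deviation_le hn hΦ hΦR hXm hcont _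
    have hm₂ : MeasurableSet S₂ := by
      refine measurableSet_le (Measurable.norm (Measurable.sub_const ?_ _)) measurable_const
      have : ∀ j, Measurable fun ω => Φ (Z j ω) := fun j => hΦ.comp (hZm j)
      unfold EPA.empMoment
      fun_prop
    -- Inclusion-exclusion suffices for `1 - 2δ`, so the two samples may be dependent.
    refine ⟨S₁ ∩ S₂, hm₁.inter hm₂, ?_, ?_⟩
    · have h1 : 1 - δ ≤ Pr.real S₁ := hα δ hδ
      have h2 : 1 - δ ≤ Pr.real S₂ :=
        EPA.one_sub_le_measureReal_norm_empMoment_sub_le hm hZm hZlaw hZind hΦ hR hΦR hδ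
      have h3 := measureReal_union_add_inter (μ := Pr) (s := S₁) hm₂
      have h4 : Pr.real (S₁ ∪ S₂) ≤ 1 := measureReal_le_one
      linarith
    · rintro ω ⟨hω₁, hω₂⟩ ξhat hξhat hdual
      have := EPA.isProbabilityMeasure_empMeasure hn fun i => X i ω
      have hghat := hdual.gradient_eq hΦ hΦR
      -- `ξhat` depends on the data, hence the need for a deviation bound uniform over `Ξ`; its
      -- empirical gradient is the empirical moment.
      have hdev : ‖gradient (EPA.logPartition PX Φ) ξhat
          - EPA.empMoment Φ (fun j => Z j ω)‖ ≤ α δ := by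
        have h : ‖gradient (EPA.logPartition PX Φ) ξhat - gradient
            (EPA.logPartition (EPA.empMeasure (fun i => X i ω)) Φ) ξhat‖ₑ
              ≤ ENNReal.ofReal (α δ) :=
          (le_iSup₂ (f := fun ξ (_ : ξ ∈ Ξ) => ‖gradient (EPA.logPartition PX Φ) ξ - gradient
            (EPA.logPartition (EPA.empMeasure (fun i => X i ω)) Φ) ξ‖ₑ) ξhat hξhat).trans hω₁
        rw [hghat, ← ofReal_norm, ENNReal.ofReal_le_ofReal_iff (hαpos δ hδ).le] at h
        exact h
      have hKL : InformationTheory.klDiv Pstar (EPA.expFamily PX Φ ξhat)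
          ≤ ENNReal.ofReal (L / 2 * ‖ξhat - ξstar‖ ^ 2) := by
        rw [hP, EPA.klDiv_expFamily_expFamily hΦ hΦR]
        exact ENNReal.ofReal_le_ofReal (EPA.le_add_inner_add_of_lipschitz_gradient hgrad hΞcvx
          hsmooth hξstarΞ hξhat)
      refine ⟨?_, hKL, ?_⟩
      · have h1 := hstrong.mul_norm_sub_le hgrad hξstarΞ hξhat
        rw [hgstar] at h1
        have h2 := norm_add_le
          (gradient (EPA.logPartition PX Φ) ξhat - EPA.empMoment Φ (fun j => Z j ω))
          (EPA.empMoment Φ (fun j => Z j ω) - ∫ x, Φ x ∂QX)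
        rw [sub_add_sub_cancel] at h2
        have h3 : ‖EPA.empMoment Φ (fun j => Z j ω) - ∫ x, Φ x ∂QX‖
          ≤ EPA.betaRate R k m δ := hω₂
        rw [one_div, le_inv_mul_iff₀ hσ]
        linarith
      · have hprob : IsProbabilityMeasure Pstar := hPstar.1.1
        have hprob' := EPA.isProbabilityMeasure_expFamily PX hΦ hΦR ξhat
        refine (EPA.tvDist_le_sqrt_klDiv (ne_top_of_le_ne_top ENNReal.ofReal_ne_top hKL)).trans
          (Real.sqrt_le_sqrt ?_)
        have h1 := ENNReal.toReal_mono ENNReal.ofReal_ne_top hKL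
        rw [ENNReal.toReal_ofReal (by positivity)] at h1
        linarith
  · intro ω hω ξhat hξhat hdual Phat hPhat
    have := EPA.isProbabilityMeasure_empMeasure hn fun i => X i ω
    obtain ⟨hnorm, -, htv⟩ := hω ξhat hξhat hdual
    have hB : ‖ξhat‖ ≤ EPA.normBound Ξ :=
      le_csSup (hΞcpt.image continuous_norm).bddAbove (Set.mem_image_of_mem _ hξhat)
    have hB0 : 0 ≤ EPA.normBound Ξ := (norm_nonneg _).trans hB
    rw [hPhat.eq_expFamily hΦ hΦR hdual]
    rw [hP] at htv ⊢
    refine (EPA.W1_expFamily_le hR.le hΦR hΦL hD0 hD ξstar hB).trans (add_le_add ?_ ?_)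
    · refine ENNReal.ofReal_le_ofReal ?_
      -- The total variation bound is linear in the parameter error, which gives the factor
      -- `D√L/(2σ)`.
      have h1 : Real.sqrt (L / 4 * ‖ξhat - ξstar‖ ^ 2) = Real.sqrt L / 2 * ‖ξhat - ξstar‖ := by
        rw [Real.sqrt_mul (by positivity), Real.sqrt_sq (norm_nonneg _),
          Real.sqrt_div hL0.le, show (4 : ℝ) = 2 ^ 2 by norm_num, Real.sqrt_sq (by norm_num)]
      rw [h1] at htv
      calc D * EPA.tvDist (EPA.expFamily PX Φ ξstar) (EPA.expFamily PX Φ ξhat)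
          ≤ D * (Real.sqrt L / 2 * (1 / σ * (α δ + EPA.betaRate R k m δ))) := by
            refine mul_le_mul_of_nonneg_left (htv.trans ?_) hD0
            exact mul_le_mul_of_nonneg_left hnorm (by positivity)
        _ = D * Real.sqrt L / (2 * σ) * (α δ + EPA.betaRate R k m δ) := by
            field_simp
    · gcongr
      exact EPA.le_stabConst hB0 hR.le LΦ.2 hD0
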